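/- **Conventions.** Let $H$ be a complex Hilbert space; inner products are linear in the second variable. A *CP map* on $B(H)$ is a completely positive, contractive, normal ($\sigma$-weakly continuous) linear map $B(H)\to B(H)$. A *CP-semigroup* on $B(H)$ is a family $R=\{R_t\}_{t\ge 0}$ of CP maps with $R_0=\mathrm{id}$, $R_{s+t}=R_s\circ R_t$ and $t\mapsto\langle R_t(a)h,g\rangle$ continuous for all $a\in B(H)$, $h,g\in H$. For CP maps $\Phi,\Theta$ on $M=B(H)$, $M\otimes_\Phi M\otimes_\Theta H$ is the Hausdorff completion of the algebraic tensor product with respect to $\langle a\otimes b\otimes h,c\otimes d\otimes k\rangle=\langle h,\Theta(b^*\Phi(a^*c)d)k\rangle$. Similarly $M\otimes_\Phi M\otimes_\Theta M$ is the W$^*$-correspondence over $M$ (the minimal self-dual extension of the algebraic tensor product) with $\langle a\otimes b\otimes c,a'\otimes b'\otimes c'\rangle=c^*\Theta(b^*\Phi(a^*a')b')c'$ and the obvious left and right actions; tensor products with more factors are defined in the same way. $\Theta$ and $\Phi$ *commute strongly* if there is a unitary $u:M\otimes_\Phi M\otimes_\Theta H\to M\otimes_\Theta M\otimes_\Phi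 H$ such that, for all $a,b,c\in M$, $d\in M'$ and $h\in H$: $u(a\otimes_\Phi I\otimes_\Theta h)=a\otimes_\Theta I\otimes_\Phi h$, $u(ca\otimes b\otimes h)=(c\otimes I\otimes I)u(a\otimes b\otimes h)$ and $u(a\otimes b\otimes dh)=(I\otimes I\otimes d)u(a\otimes b\otimes h)$. CP-semigroups $R,S$ on $M$ *strongly commute* if $R_s$ and $S_t$ commute strongly for all $s,t\ge0$, and there are isomorphisms of W$^*$-correspondences (unitary bimodule maps) $v_{s,t}:M\otimes_{R_s}M\otimes_{S_t}M\to M\otimes_{S_t}M\otimes_{R_s}M$ ($s,t\ge 0$) with $v_{s,t}(I\otimes I\otimes I)=I\otimes I\otimes I$ such that for all $s,s',t,t'\ge0$ $$W\,v_{s+s',t}=(v_{s,t}\otimes I)(I\otimes v_{s',t})\,V,\qquad W'\,v_{s,t+t'}=(I\otimes v_{s,t'})(v_{s,t}\otimes I)\,V',$$ where $V,W,V',W'$ are the canonical isometries $$V:\ a\otimes_{R_{s+s'}}b\otimes_{S_t}c\mapsto a\otimes_{R_s}I\otimes_{R_{s'}}b\otimes_{S_t}c,\qquad W:\ a\otimes_{S_t}b\otimes_{R_{s+s'}}c\mapsto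 a\otimes_{S_t}b\otimes_{R_s}I\otimes_{R_{s'}}c,$$ $$V':\ a\otimes_{R_s}b\otimes_{S_{t+t'}}c\mapsto a\otimes_{R_s}b\otimes_{S_t}I\otimes_{S_{t'}}c,\qquad W':\ a\otimes_{S_{t+t'}}b\otimes_{R_s}c\mapsto a\otimes_{S_t}I\otimes_{S_{t'}}b\otimes_{R_s}c.$$ **Proposition.** Let $T^1=\{T^1_t\}_{t\ge0}$ and $T^2=\{T^2_t\}_{t\ge0}$ be two semigroups of contractions in $B(H)$ (so $T^i_0=I$, $T^i_{s+t}=T^i_sT^i_t$, $\|T^i_t\|\le 1$) that are continuous in the strong operator topology and commute: $T^1_sT^2_t=T^2_tT^1_s$ for all $s,t\ge 0$. Then $$\phi^i_t(a)=T^i_t\,a\,(T^i_t)^*,\qquad a\in B(H),\ t\ge0,\ i=1,2,$$ define CP-semigroups $\phi^1,\phi^2$ on $B(H)$, and $\phi^1$ and $\phi^2$ strongly commute. -/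

import Mathlib

open scoped TensorProduct InnerProductSpace ComplexConjugate NNReal CStarAlgebra

noncomputable section

namespace CPDil

universe u

/-! ### Normal maps, CP maps and CP-semigroups on `B(H)` -/

section CP

variable (H : Type u) [NormedAddCommGroup H] [InnerProductSpace ℂ H] [CompleteSpace H]

/-- The σ-weak (ultraweak) topology of `B(H)`: the initial topology of the functionals
`a ↦ ∑ₙ ⟨gₙ, a hₙ⟩`, where `h` and `g` are square-summable sequences in `H`. -/
@[reducible] def sigmaWeak : TopologicalSpace (H →L[ℂ] H) :=
  TopologicalSpace.induced
    (fun a (p : lp (fun _ : ℕ => H) 2 × lp (fun _ : ℕ => H) 2) =>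
      ∑' n, ⟪p.2 n, a (p.1 n)⟫_ℂ)
    inferInstance

/-- A CP map on `B(H)`: a completely positive, contractive, normal (σ-weakly continuous) linear
map. -/
structure CPMap extends (H →L[ℂ] H) →CP (H →L[ℂ] H) where
  contractive : ∀ a, ‖toFun a‖ ≤ ‖a‖
  normal : @Continuous _ _ (sigmaWeak H) (sigmaWeak H) toFun

instance : CoeFun (CPMap H) fun _ => (H →L[ℂ] H) → (H →L[ℂ] H) :=
  ⟨fun Φ => Φ.toFun⟩

/-- A CP-semigroup on `B(H)`, indexed by `t ≥ 0`. -/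
structure CPSemigroup where
  toMap : ℝ≥0 → CPMap H
  map_zero : ∀ a, toMap 0 a = a
  map_add : ∀ s t a, toMap (s + t) a = toMap s (toMap t a)
  continuous : ∀ (a : H →L[ℂ] H) (h g : H), Continuous fun t => ⟪toMap t a h, g⟫_ℂ

instance : CoeFun (CPSemigroup H) fun _ => ℝ≥0 → CPMap H := ⟨CPSemigroup.toMap⟩

/-- A semigroup of contractions on `H`, continuous in the strong operator topology. -/
structure ContractionSemigroup where
  toFun : ℝ≥0 → (H →L[ℂ] H)
  map_zero : toFun 0 = 1
  map_add : ∀ s t, toFun (s + t) = toFun s * toFun t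
  contractive : ∀ t, ‖toFun t‖ ≤ 1
  continuous : ∀ h : H, Continuous fun t => toFun t h

instance : CoeFun (ContractionSemigroup H) fun _ => ℝ≥0 → (H →L[ℂ] H) :=
  ⟨ContractionSemigroup.toFun⟩

end CP

/-! ### Semi-inner product spaces with a left action of `B(H)`, and their Hausdorff completions -/

/-- A complex vector space with a positive semidefinite sesquilinear form (conjugate-linear in
the first variable) and a left `*`-action of `B(H)`. -/
structure PreRep (H : Type u) [NormedAddCommGroup H] [InnerProductSpace ℂ H]
    [CompleteSpace H] where
  carrier : Type u
  [addCommGroup : AddCommGroup carrier]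
  [module : Module ℂ carrier]
  form : carrier →ₗ⋆[ℂ] carrier →ₗ[ℂ] ℂ
  conj_symm : ∀ x y, conj (form x y) = form y x
  nonneg : ∀ x, 0 ≤ (form x x).re
  act : (H →L[ℂ] H) →ₐ[ℂ] Module.End ℂ carrier
  act_adj : ∀ a x y, form (act a x) y = form x (act (star a) y)

attribute [instance] PreRep.addCommGroup PreRep.module

variable {H : Type u} [NormedAddCommGroup H] [InnerProductSpace ℂ H] [CompleteSpace H]

namespace PreRep

/-- The pre-inner product of the form. -/
instance core (V : PreRep H) : PreInnerProductSpace.Core ℂ V.carrier where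
  inner x y := V.form x y
  conj_inner_symm x y := V.conj_symm y x
  re_inner_nonneg x := V.nonneg x
  add_left x y z := by simp
  smul_left x y r := by simp

instance (V : PreRep H) : SeminormedAddCommGroup V.carrier :=
  InnerProductSpace.Core.toSeminormedAddCommGroup (𝕜 := ℂ)

instance (V : PreRep H) : InnerProductSpace ℂ V.carrier :=
  InnerProductSpace.ofCore V.core

theorem inner_eq (V : PreRep H) (x y : V.carrier) : ⟪x, y⟫_ℂ = V.form x y := rfl

theorem norm_sq (V : PreRep H) (x : V.carrier) : ‖x‖ ^ 2 = (V.form x x).re := by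
  rw [← V.inner_eq, norm_sq_eq_re_inner (𝕜 := ℂ)]; rfl

/-- The Hilbert space obtained as the Hausdorff completion of `V` with respect to its form. -/
abbrev Hilb (V : PreRep H) : Type u := UniformSpace.Completion V.carrier

theorem norm_act_le (V : PreRep H) (a : H →L[ℂ] H) (x : V.carrier) :
    ‖V.act a x‖ ≤ ‖a‖ * ‖x‖ := by
  have h1 : 0 ≤ algebraMap ℝ (H →L[ℂ] H) (‖a‖ ^ 2) - star a * a :=
    sub_nonneg.2 CStarAlgebra.star_mul_le_algebraMap_norm_sq
  obtain ⟨d, hd⟩ := CStarAlgebra.nonneg_iff_eq_star_mul_self.1 h1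
  have h2 : V.form x (V.act (star d * d) x) =
      ((‖a‖ ^ 2 : ℝ) : ℂ) * V.form x x - V.form x (V.act (star a * a) x) := by
    have h3 : algebraMap ℝ (H →L[ℂ] H) (‖a‖ ^ 2) =
        algebraMap ℂ (H →L[ℂ] H) ((‖a‖ ^ 2 : ℝ) : ℂ) := by
      simp only [Algebra.algebraMap_eq_smul_one, Complex.coe_smul]
    rw [← hd, h3, map_sub, AlgHom.commutes, LinearMap.sub_apply, map_sub,
      Module.algebraMap_end_apply, map_smul, smul_eq_mul]
  have h4 : ∀ b : H →L[ℂ] H, V.form x (V.act (star b * b) x) = V.form (V.act b x) (V.act b x) := by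
    intro b
    rw [V.act_adj, map_mul]; rfl
  rw [h4, h4] at h2
  have h5 := congrArg Complex.re h2
  rw [Complex.sub_re, Complex.re_ofReal_mul, ← V.norm_sq, ← V.norm_sq, ← V.norm_sq] at h5
  refine abs_le_of_sq_le_sq' ?_ (by positivity) |>.2
  nlinarith [sq_nonneg ‖V.act d x‖]

/-- The action of `a ∈ B(H)` on the Hausdorff completion. -/
def left (V : PreRep H) (a : H →L[ℂ] H) : V.Hilb →L[ℂ] V.Hilb :=
  ((V.act a).mkContinuous ‖a‖ (V.norm_act_le a)).completion

/-- A linear map that preserves the forms and commutes with the left actions. -/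
structure Hom (V W : PreRep H) where
  toLin : V.carrier →ₗ[ℂ] W.carrier
  map_form : ∀ x y, W.form (toLin x) (toLin y) = V.form x y
  map_act : ∀ a x, toLin (V.act a x) = W.act a (toLin x)

theorem Hom.norm_map {V W : PreRep H} (f : Hom V W) (x : V.carrier) : ‖f.toLin x‖ = ‖x‖ := by
  have h := W.norm_sq (f.toLin x)
  rw [f.map_form, ← V.norm_sq] at h
  exact (sq_eq_sq₀ (norm_nonneg _) (norm_nonneg _)).1 h

/-- The isometry of the Hausdorff completions induced by a form-preserving map. -/
def Hom.hilb {V W : PreRep H} (f : Hom V W) : V.Hilb →L[ℂ] W.Hilb :=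
  (f.toLin.mkContinuous 1 fun x => by rw [f.norm_map, one_mul]).completion

/-- `H` itself, with its inner product and the identity representation of `B(H)`. -/
def base (H : Type u) [NormedAddCommGroup H] [InnerProductSpace ℂ H] [CompleteSpace H] :
    PreRep H where
  carrier := H
  form := innerₛₗ ℂ
  conj_symm x y := inner_conj_symm y x
  nonneg x := inner_self_nonneg (𝕜 := ℂ)
  act :=
    { toFun := fun a => (a : H →ₗ[ℂ] H)
      map_one' := rfl
      map_mul' := fun _ _ => rfl
      map_zero' := rfl
      map_add' := fun _ _ => rfl
      commutes' := fun _ => rfl }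
  act_adj a x y := by
    rw [ContinuousLinearMap.star_eq_adjoint]
    exact (ContinuousLinearMap.adjoint_inner_right a x y).symm

/-- The canonical map of `H` onto its own completion. -/
def baseIn (H : Type u) [NormedAddCommGroup H] [InnerProductSpace ℂ H] [CompleteSpace H] :
    H →L[ℂ] (base H).Hilb :=
  let f : H →ₗ[ℂ] (base H).Hilb :=
    (UniformSpace.Completion.toComplₗᵢ (𝕜 := ℂ) (E := (base H).carrier)).toLinearMap
  f.mkContinuous 1 fun x => by
    have h1 : ‖f x‖ = ‖(show (base H).carrier from x)‖ := UniformSpace.Completion.norm_coe _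
    have h2 : ‖(show (base H).carrier from x)‖ ^ 2 = ‖x‖ ^ 2 := by
      rw [norm_sq]
      exact (norm_sq_eq_re_inner (𝕜 := ℂ) x).symm
    rw [h1, one_mul, (sq_eq_sq₀ (norm_nonneg _) (norm_nonneg _)).1 h2]

/-- The sesquilinear form on `B(H) ⊗ V` with
`⟨a ⊗ x, c ⊗ y⟩ = ⟨x, Φ(a* c) y⟩`. -/
def tensForm (Φ : CPMap H) (V : PreRep H) :
    ((H →L[ℂ] H) ⊗[ℂ] V.carrier) →ₗ⋆[ℂ] ((H →L[ℂ] H) ⊗[ℂ] V.carrier) →ₗ[ℂ] ℂ :=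
  TensorProduct.lift <|
    LinearMap.mk₂'ₛₗ (starRingEnd ℂ) (starRingEnd ℂ)
      (fun a x => TensorProduct.lift <|
        LinearMap.mk₂ ℂ (fun c y => V.form x (V.act (Φ.toLinearMap (star a * c)) y))
          (by intros; simp [mul_add]) (by intros; simp) (by intros; simp) (by intros; simp))
      (by intros; ext; simp [add_mul]) (by intros; ext; simp)
      (by intros; ext; simp) (by intros; ext; simp)

theorem tensForm_tmul (Φ : CPMap H) (V : PreRep H) (a c : H →L[ℂ] H) (x y : V.carrier) :
    tensForm Φ V (a ⊗ₜ x) (c ⊗ₜ y) = V.form x (V.act (Φ (star a * c)) y) := rfl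

theorem CPMap_star (Φ : CPMap H) (a : H →L[ℂ] H) : Φ (star a) = star (Φ a) :=
  map_star Φ.toCompletelyPositiveMap a

theorem tensForm_symm (Φ : CPMap H) (V : PreRep H) (x y : (H →L[ℂ] H) ⊗[ℂ] V.carrier) :
    conj (tensForm Φ V x y) = tensForm Φ V y x := by
  induction x with
  | zero => simp
  | add x x' hx hx' => simp [hx, hx']
  | tmul a x =>
    induction y with
    | zero => simp
    | add y y' hy hy' => simp [hy, hy']
    | tmul c y =>
      rw [tensForm_tmul, tensForm_tmul, V.conj_symm, V.act_adj, ← CPMap_star]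
      simp

theorem form_sum_nonneg (V : PreRep H) {n : ℕ} (x : Fin n → V.carrier)
    (M : CStarMatrix (Fin n) (Fin n) (H →L[ℂ] H)) (hM : 0 ≤ M) :
    0 ≤ (∑ i, ∑ j, V.form (x i) (V.act (M i j) (x j))).re := by
  rw [StarOrderedRing.nonneg_iff] at hM
  induction hM using AddSubmonoid.closure_induction with
  | mem M hM =>
    obtain ⟨Y, rfl⟩ := hM
    have h : ∑ i, ∑ j, V.form (x i) (V.act ((star Y * Y) i j) (x j)) =
        ∑ l, V.form (∑ i, V.act (Y l i) (x i)) (∑ j, V.act (Y l j) (x j)) := by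
      simp only [CStarMatrix.mul_apply, CStarMatrix.star_apply, map_sum, LinearMap.sum_apply,
        map_mul, Module.End.mul_apply, V.act_adj]
      rw [Finset.sum_comm_cycle]
      exact Finset.sum_congr rfl fun l _ => Finset.sum_comm
    change 0 ≤ (∑ i, ∑ j, V.form (x i) (V.act ((star Y * Y) i j) (x j))).re
    rw [h, Complex.re_sum]
    exact Finset.sum_nonneg fun l _ => V.nonneg _
  | zero => simp
  | add M N _ _ hM hN =>
    simp only [CStarMatrix.add_apply, map_add, LinearMap.add_apply, Finset.sum_add_distrib,
      Complex.add_re]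
    exact add_nonneg hM hN

theorem gram_nonneg {n : ℕ} (a : Fin n → (H →L[ℂ] H)) :
    0 ≤ (CStarMatrix.ofMatrix (Matrix.of fun i j => star (a i) * a j) :
      CStarMatrix (Fin n) (Fin n) (H →L[ℂ] H)) := by
  rcases n with _ | n
  · exact le_of_eq (CStarMatrix.ext fun i => i.elim0)
  · have h : (CStarMatrix.ofMatrix (Matrix.of fun i j => star (a i) * a j) :
        CStarMatrix (Fin (n + 1)) (Fin (n + 1)) (H →L[ℂ] H)) =
        star (CStarMatrix.ofMatrix (Matrix.of fun i j => if i = 0 then a j else 0)) *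
          CStarMatrix.ofMatrix (Matrix.of fun i j => if i = 0 then a j else 0) := by
      ext1 i j
      rw [CStarMatrix.mul_apply, Finset.sum_eq_single 0]
      · rw [CStarMatrix.star_apply]
        simp [CStarMatrix.ofMatrix_apply]
      · intro b _ hb
        simp [CStarMatrix.ofMatrix_apply, hb]
      · simp
    rw [h]
    exact star_mul_self_nonneg _

theorem tensForm_nonneg (Φ : CPMap H) (V : PreRep H) (z : (H →L[ℂ] H) ⊗[ℂ] V.carrier) :
    0 ≤ (tensForm Φ V z z).re := by
  obtain ⟨k, a, x, rfl⟩ := TensorProduct.exists_sum_tmul_eq z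
  have h := V.form_sum_nonneg x _ (Φ.map_cstarMatrix_nonneg' k _ (gram_nonneg a))
  simp only [map_sum, LinearMap.sum_apply, tensForm_tmul]
  rw [Finset.sum_comm]
  exact h

/-- `B(H) ⊗_Φ V`: the algebraic tensor product `B(H) ⊗ V` with the form
`⟨a ⊗ x, c ⊗ y⟩ = ⟨x, Φ(a* c) y⟩` and the left action `c · (a ⊗ x) = c a ⊗ x`. -/
def tens (Φ : CPMap H) (V : PreRep H) : PreRep H where
  carrier := (H →L[ℂ] H) ⊗[ℂ] V.carrier
  form := tensForm Φ V
  conj_symm := tensForm_symm Φ V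
  nonneg := tensForm_nonneg Φ V
  act := (Module.End.rTensorAlgHom ℂ (H →L[ℂ] H) V.carrier).comp (Algebra.lmul ℂ (H →L[ℂ] H))
  act_adj c x y := by
    induction x with
    | zero => simp
    | add x x' hx hx' => simp only [map_add, LinearMap.add_apply, hx, hx']
    | tmul a x =>
      induction y with
      | zero => simp
      | add y y' hy hy' => simp only [map_add, hy, hy']
      | tmul b y =>
        change tensForm Φ V ((c * a) ⊗ₜ x) (b ⊗ₜ y) = tensForm Φ V (a ⊗ₜ x) ((star c * b) ⊗ₜ y)
        rw [tensForm_tmul, tensForm_tmul, star_mul, mul_assoc]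

/-- The elementary tensor `a ⊗ x`. -/
def tmul (Φ : CPMap H) (V : PreRep H) (a : H →L[ℂ] H) : V.carrier →ₗ[ℂ] (tens Φ V).carrier :=
  TensorProduct.mk ℂ (H →L[ℂ] H) V.carrier a

theorem form_tmul (Φ : CPMap H) (V : PreRep H) (a c : H →L[ℂ] H) (x y : V.carrier) :
    (tens Φ V).form (tmul Φ V a x) (tmul Φ V c y) = V.form x (V.act (Φ (star a * c)) y) := rfl

theorem act_tmul (Φ : CPMap H) (V : PreRep H) (a c : H →L[ℂ] H) (x : V.carrier) :
    (tens Φ V).act c (tmul Φ V a x) = tmul Φ V (c * a) x := rfl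

theorem tens_induction {Φ : CPMap H} {V : PreRep H} {p : (tens Φ V).carrier → Prop}
    (h0 : p 0) (h1 : ∀ a x, p (tmul Φ V a x)) (h2 : ∀ x y, p x → p y → p (x + y))
    (z : (tens Φ V).carrier) : p z :=
  TensorProduct.induction_on z h0 h1 h2

theorem norm_tmul_le (Φ : CPMap H) (V : PreRep H) (a : H →L[ℂ] H) (x : V.carrier) :
    ‖tmul Φ V a x‖ ≤ ‖a‖ * ‖x‖ := by
  refine abs_le_of_sq_le_sq' ?_ (by positivity) |>.2
  rw [norm_sq, form_tmul, ← inner_eq]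
  calc (⟪x, V.act (Φ (star a * a)) x⟫_ℂ).re ≤ ‖x‖ * ‖V.act (Φ (star a * a)) x‖ :=
        re_inner_le_norm (𝕜 := ℂ) _ _
    _ ≤ ‖x‖ * (‖Φ (star a * a)‖ * ‖x‖) := by gcongr; exact V.norm_act_le _ _
    _ ≤ ‖x‖ * (‖star a * a‖ * ‖x‖) := by gcongr; exact Φ.contractive _
    _ = (‖a‖ * ‖x‖) ^ 2 := by rw [CStarRing.norm_star_mul_self]; ring

/-- The operator `k ↦ a ⊗ k` from the completion of `V` to the completion of `B(H) ⊗_Φ V`. -/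
def ket (Φ : CPMap H) (V : PreRep H) (a : H →L[ℂ] H) : V.Hilb →L[ℂ] (tens Φ V).Hilb :=
  ((tmul Φ V a).mkContinuous ‖a‖ (norm_tmul_le Φ V a)).completion

/-- The linear map `B(H) ⊗_Θ V → B(H) ⊗_Φ W`, `a ⊗ x ↦ a ⊗ f x`. -/
def mapTens (Θ Φ : CPMap H) {V W : PreRep H} (f : V.carrier →ₗ[ℂ] W.carrier) :
    (tens Θ V).carrier →ₗ[ℂ] (tens Φ W).carrier :=
  LinearMap.lTensor (H →L[ℂ] H) f

theorem mapTens_tmul (Θ Φ : CPMap H) {V W : PreRep H} (f : V.carrier →ₗ[ℂ] W.carrier)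
    (a : H →L[ℂ] H) (x : V.carrier) :
    mapTens Θ Φ f (tmul Θ V a x) = tmul Φ W a (f x) := rfl

/-- For `f` commuting with the left actions, the isometry induced by `a ⊗ x ↦ a ⊗ f x`. -/
def Hom.idTens (Φ : CPMap H) {V W : PreRep H} (f : Hom V W) : Hom (tens Φ V) (tens Φ W) where
  toLin := mapTens Φ Φ f.toLin
  map_form x y := by
    induction x using tens_induction with
    | h0 => simp
    | h2 x x' hx hx' => simp only [map_add, LinearMap.add_apply, hx, hx']
    | h1 a x =>
      induction y using tens_induction with
      | h0 => simp
      | h2 y y' hy hy' => simp only [map_add, hy, hy']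
      | h1 c y =>
        rw [mapTens_tmul, mapTens_tmul, form_tmul, form_tmul, ← f.map_act, f.map_form]
  map_act c x := by
    induction x using tens_induction with
    | h0 => simp
    | h2 x x' hx hx' => simp only [map_add, hx, hx']
    | h1 a x => rfl

/-- For `Θ = Ψ ∘ Φ`, the map `B(H) ⊗_Θ V → B(H) ⊗_Φ B(H) ⊗_Ψ V`, `a ⊗ x ↦ a ⊗ I ⊗ x`. -/
def split {Θ Φ Ψ : CPMap H} (h : ∀ a, Θ a = Ψ (Φ a)) (V : PreRep H) :
    Hom (tens Θ V) (tens Φ (tens Ψ V)) where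
  toLin := mapTens Θ Φ (tmul Ψ V 1)
  map_form x y := by
    induction x using tens_induction with
    | h0 => simp
    | h2 x x' hx hx' => simp only [map_add, LinearMap.add_apply, hx, hx']
    | h1 a x =>
      induction y using tens_induction with
      | h0 => simp
      | h2 y y' hy hy' => simp only [map_add, hy, hy']
      | h1 c y =>
        rw [mapTens_tmul, mapTens_tmul, form_tmul, act_tmul, form_tmul, form_tmul, h]
        simp
  map_act c x := by
    induction x using tens_induction with
    | h0 => simp
    | h2 x x' hx hx' => simp only [map_add, hx, hx']
    | h1 a x => rfl

end PreRep

open PreRep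

/-! ### Strong commutation of CP maps -/

/-- The elementary tensor `a ⊗_Φ b ⊗_Θ h` in the Hilbert space `B(H) ⊗_Φ B(H) ⊗_Θ H`. -/
def vec (Φ Θ : CPMap H) (a b : H →L[ℂ] H) (h : H) : (tens Φ (tens Θ (base H))).Hilb :=
  ket Φ _ a (ket Θ _ b (baseIn H h))

/-- `⟨a ⊗ b ⊗ h, c ⊗ d ⊗ k⟩ = ⟨h, Θ(b* Φ(a* c) d) k⟩`. -/
theorem inner_vec (Φ Θ : CPMap H) (a b c d : H →L[ℂ] H) (h k : H) :
    ⟪vec Φ Θ a b h, vec Φ Θ c d k⟫_ℂ = ⟪h, Θ (star b * Φ (star a * c) * d) k⟫_ℂ := by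
  have e : ∀ (a b : H →L[ℂ] H) (h : H), vec Φ Θ a b h =
      ((tmul Φ _ a (tmul Θ (base H) b h) : (tens Φ (tens Θ (base H))).carrier) :
        (tens Φ (tens Θ (base H))).Hilb) := by
    intro a b h
    have e1 : ket Θ (base H) b (baseIn H h) =
        ((tmul Θ (base H) b h : (tens Θ (base H)).carrier) : (tens Θ (base H)).Hilb) :=
      ContinuousLinearMap.completion_apply_coe _ _
    rw [vec, e1]
    exact ContinuousLinearMap.completion_apply_coe _ _
  rw [e, e, UniformSpace.Completion.inner_coe, mul_assoc]
  rfl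

/-- Strong commutation of two CP maps on `B(H)`. The commutant of `B(H)` consists of the scalar
operators, and `I ⊗ I ⊗ z` is multiplication by the scalar `z`. -/
def CommuteStrongly (Θ Φ : CPMap H) : Prop :=
  ∃ u : (tens Φ (tens Θ (base H))).Hilb ≃ₗᵢ[ℂ] (tens Θ (tens Φ (base H))).Hilb,
    (∀ (a : H →L[ℂ] H) (h : H), u (vec Φ Θ a 1 h) = vec Θ Φ a 1 h) ∧
    (∀ (a b c : H →L[ℂ] H) (h : H),
      u (vec Φ Θ (c * a) b h) = (tens Θ (tens Φ (base H))).left c (u (vec Φ Θ a b h))) ∧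
    (∀ (a b : H →L[ℂ] H) (z : ℂ) (h : H), u (vec Φ Θ a b (z • h)) = z • u (vec Φ Θ a b h))

/-! ### W*-correspondences over `B(H)` -/

/-- For `V = B(H) ⊗_Φ ⋯ ⊗_Ψ H` with completion `K`, the W*-correspondence
`B(H) ⊗_Φ ⋯ ⊗_Ψ B(H)` over `B(H)`, in its concrete form `B(H, K)`:
the inner product is `⟨x, y⟩ = x* y`, the right action is `x · a = x ∘ a`, the left action is
`c · x = (c ⊗ I ⊗ ⋯ ⊗ I) ∘ x`, and `a ⊗ ⋯ ⊗ b ⊗ c` is the operator `h ↦ a ⊗ ⋯ ⊗ b ⊗ c h`.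
The elementary tensors have the inner products that define the tensor product, and
`B(H, K)` is the closure of their span in the strong operator topology, that is, the minimal
self-dual extension of the algebraic tensor product. -/
abbrev Corr (V : PreRep H) : Type u := H →L[ℂ] V.Hilb

/-- The `B(H)`-valued inner product of a correspondence. -/
def Corr.inner {V : PreRep H} (x y : Corr V) : H →L[ℂ] H := ContinuousLinearMap.adjoint x ∘L y

/-- The elementary tensor `a ⊗_Φ b ⊗_Ψ c` of `B(H) ⊗_Φ B(H) ⊗_Ψ B(H)`. -/
def elem₃ (Φ Ψ : CPMap H) (a b c : H →L[ℂ] H) : Corr (tens Φ (tens Ψ (base H))) :=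
  ket Φ _ a ∘L ket Ψ _ b ∘L baseIn H ∘L c

/-- The elementary tensor `a ⊗_Φ b ⊗_Ψ c ⊗_Ω d` of `B(H) ⊗_Φ B(H) ⊗_Ψ B(H) ⊗_Ω B(H)`. -/
def elem₄ (Φ Ψ Ω : CPMap H) (a b c d : H →L[ℂ] H) :
    Corr (tens Φ (tens Ψ (tens Ω (base H)))) :=
  ket Φ _ a ∘L ket Ψ _ b ∘L ket Ω _ c ∘L baseIn H ∘L d

theorem inner_elem₃ (Φ Ψ : CPMap H) (a b c a' b' c' : H →L[ℂ] H) :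
    (elem₃ Φ Ψ a b c).inner (elem₃ Φ Ψ a' b' c') =
      star c * Ψ (star b * Φ (star a * a') * b') * c' := by
  ext k
  refine ext_inner_left ℂ fun h => ?_
  have e := inner_vec Φ Ψ a b a' b' (c h) (c' k)
  rw [Corr.inner, ContinuousLinearMap.comp_apply, ContinuousLinearMap.adjoint_inner_right]
  refine e.trans ?_
  rw [mul_assoc (star c), ContinuousLinearMap.star_eq_adjoint c]
  exact (ContinuousLinearMap.adjoint_inner_right c h _).symm

/-- An isomorphism of W*-correspondences: a unitary bimodule map. -/
structure CorrIso (V W : PreRep H) extends Corr V ≃ₗ[ℂ] Corr W where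
  map_inner : ∀ x y : Corr V, (toFun x).inner (toFun y) = x.inner y
  map_right : ∀ (x : Corr V) (a : H →L[ℂ] H), toFun (x ∘L a) = toFun x ∘L a
  map_left : ∀ (c : H →L[ℂ] H) (x : Corr V), toFun (V.left c ∘L x) = W.left c ∘L toFun x

instance (V W : PreRep H) : CoeFun (CorrIso V W) fun _ => Corr V → Corr W := ⟨fun v => v.toFun⟩

/-- `L` is the map `I ⊗ v` on `B(H) ⊗_Φ V`, that is `L (a ⊗ x) = a ⊗ v x`. -/
def IsIdTensor (Φ : CPMap H) {V W : PreRep H} (v : CorrIso V W)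
    (L : CorrIso (tens Φ V) (tens Φ W)) : Prop :=
  ∀ (a : H →L[ℂ] H) (x : Corr V), L (ket Φ V a ∘L x) = ket Φ W a ∘L v x

/-- `L` is the map `v ⊗ I` from `(B(H) ⊗_Φ B(H) ⊗_Ψ B(H)) ⊗_Ω B(H)` to
`(B(H) ⊗_Ψ B(H) ⊗_Φ B(H)) ⊗_Ω B(H)`: with `⟨y ⊗ d', x ⊗ d⟩ = d'* Ω(⟨y, x⟩) d`, the vector
`L ((a ⊗ b ⊗ c) ⊗ d) = v (a ⊗ b ⊗ c) ⊗ d` is determined by its inner products with the elementary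
tensors `(a' ⊗ b' ⊗ c') ⊗ d'`. -/
def IsTensorId {Φ Ψ : CPMap H}
    (v : CorrIso (tens Φ (tens Ψ (base H))) (tens Ψ (tens Φ (base H)))) (Ω : CPMap H)
    (L : CorrIso (tens Φ (tens Ψ (tens Ω (base H)))) (tens Ψ (tens Φ (tens Ω (base H))))) :
    Prop :=
  ∀ a b c d a' b' c' d' : H →L[ℂ] H,
    (elem₄ Ψ Φ Ω a' b' c' d').inner (L (elem₄ Φ Ψ Ω a b c d)) =
      star d' * Ω ((elem₃ Ψ Φ a' b' c').inner (v (elem₃ Φ Ψ a b c))) * d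

/-! ### Strong commutation of CP-semigroups -/

theorem CPSemigroup.map_add' (R : CPSemigroup H) (s s' : ℝ≥0) (a : H →L[ℂ] H) :
    R (s + s') a = R s' (R s a) := by
  rw [add_comm, R.map_add]

/-- The isometry `a ⊗_{P_{s+s'}} x ↦ a ⊗_{P_s} I ⊗_{P_{s'}} x`; for `V = B(H) ⊗_Φ H` it is the map
`B(H) ⊗_{P_{s+s'}} B(H) ⊗_Φ B(H) → B(H) ⊗_{P_s} B(H) ⊗_{P_{s'}} B(H) ⊗_Φ B(H)`,
`a ⊗ b ⊗ c ↦ a ⊗ I ⊗ b ⊗ c`. -/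
def splitFirst (P : CPSemigroup H) (s s' : ℝ≥0) (V : PreRep H) (x : Corr (tens (P (s + s')) V)) :
    Corr (tens (P s) (tens (P s') V)) :=
  (split (P.map_add' s s') V).hilb ∘L x

/-- The isometry
`B(H) ⊗_Φ B(H) ⊗_{P_{s+s'}} B(H) → B(H) ⊗_Φ B(H) ⊗_{P_s} B(H) ⊗_{P_{s'}} B(H)`,
`a ⊗ b ⊗ c ↦ a ⊗ b ⊗ I ⊗ c`. -/
def splitSecond (Φ : CPMap H) (P : CPSemigroup H) (s s' : ℝ≥0)
    (x : Corr (tens Φ (tens (P (s + s')) (base H)))) :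
    Corr (tens Φ (tens (P s) (tens (P s') (base H)))) :=
  ((split (P.map_add' s s') (base H)).idTens Φ).hilb ∘L x

/-- Strong commutation of two CP-semigroups on `B(H)`: all pairs `R_s`, `S_t` commute strongly,
and this is implemented by isomorphisms of W*-correspondences
`v_{s,t} : B(H) ⊗_{R_s} B(H) ⊗_{S_t} B(H) → B(H) ⊗_{S_t} B(H) ⊗_{R_s} B(H)`
that map `I ⊗ I ⊗ I` to `I ⊗ I ⊗ I` and are compatible with the semigroup laws:
`W ∘ v_{s+s',t} = (v_{s,t} ⊗ I) (I ⊗ v_{s',t}) ∘ V` and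
`W ∘ v_{s,t+t'} = (I ⊗ v_{s,t'}) (v_{s,t} ⊗ I) ∘ V` for the canonical isometries `V`, `W`. -/
def StronglyCommute (R S : CPSemigroup H) : Prop :=
  (∀ s t, CommuteStrongly (R s) (S t)) ∧
  ∃ v : ∀ s t : ℝ≥0,
      CorrIso (tens (R s) (tens (S t) (base H))) (tens (S t) (tens (R s) (base H))),
    (∀ s t, v s t (elem₃ (R s) (S t) 1 1 1) = elem₃ (S t) (R s) 1 1 1) ∧
    (∀ s s' t : ℝ≥0,
      ∃ (L₁ : CorrIso (tens (R s) (tens (R s') (tens (S t) (base H))))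
          (tens (R s) (tens (S t) (tens (R s') (base H)))))
        (L₂ : CorrIso (tens (R s) (tens (S t) (tens (R s') (base H))))
          (tens (S t) (tens (R s) (tens (R s') (base H))))),
        IsIdTensor (R s) (v s' t) L₁ ∧ IsTensorId (v s t) (R s') L₂ ∧
        ∀ x, splitSecond (S t) R s s' (v (s + s') t x) = L₂ (L₁ (splitFirst R s s' _ x))) ∧
    (∀ s t t' : ℝ≥0,
      ∃ (L₁ : CorrIso (tens (R s) (tens (S t) (tens (S t') (base H))))
          (tens (S t) (tens (R s) (tens (S t') (base H)))))
        (L₂ : CorrIso (tens (S t) (tens (R s) (tens (S t') (base H))))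
          (tens (S t) (tens (S t') (tens (R s) (base H))))),
        IsTensorId (v s t) (S t') L₁ ∧ IsIdTensor (S t) (v s t') L₂ ∧
        ∀ x, splitFirst S t t' _ (v s (t + t') x) = L₂ (L₁ (splitSecond (R s) S t t' x)))

end CPDil

end

noncomputable section

namespace CPDil

universe u

variable {H : Type u} [NormedAddCommGroup H] [InnerProductSpace ℂ H] [CompleteSpace H]

open PreRep

/-! ### The CP-semigroup `a ↦ T_t a T_t*` of a contraction semigroup -/

/-! When `Φ a = A a A*`, the form on `B(H) ⊗_Φ V` satisfies ⟨a ⊗ x, c ⊗ y⟩ = ⟨x, A a* c A* y⟩ = ⟨aA*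
x, cA* y⟩. So a form-preserving module map `f : V → X` yields another one, a ⊗ x ↦ aA* · f x
(`Hom.conjTens`). Starting from the identity of `H`, every iterated tensor product embeds
isometrically into `H` itself; a ⊗ b ⊗ h goes to aA*bB*h.

Since `B(H)` acts transitively on nonzero vectors, a tensor factor with A ≠ 0 leaves the range of
the embedding unchanged, and one with A = 0 kills it. Hence the range does not depend on the order
of the factors (`Hom.range_conjTens_comm`), and two embeddings with equal range define a unitary U
by g ∘ U = f (`Hom.hilbEquiv`). This U is the flip. It sends I ⊗ I ⊗ h to I ⊗ I ⊗ h because A*B* =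
B*A*.

The coherence conditions hold automatically: the flips, their tensor products with I and the
canonical isometries all commute with the embeddings into `H`, which are injective.

The analytic part is that each φ_t is normal and completely positive, and that t ↦ T_t* is strongly
continuous, which yields weak continuity of t ↦ T_t a T_t*. -/

/-- The square-summable sequence `n ↦ A (h n)`. -/
def lpMap (A : H →L[ℂ] H) (h : lp (fun _ : ℕ => H) 2) : lp (fun _ : ℕ => H) 2 :=
  ⟨fun n => A (h n), by
    have h1 : Summable fun n => ‖h n‖ ^ (2 : ENNReal).toReal := (lp.memℓp h).summable (by simp)
    refine memℓp_gen (.of_nonneg_of_le (fun n => by positivity) (fun n => ?_)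
      (h1.mul_left (‖A‖ ^ (2 : ENNReal).toReal)))
    rw [← Real.mul_rpow (norm_nonneg _) (norm_nonneg _)]
    exact Real.rpow_le_rpow (norm_nonneg _) (A.le_opNorm _) (by simp)⟩

/-- Moving `A` to the other side of the inner product turns the functional of a pair of sequences,
evaluated at A a A*, into the functional of their images under A*, evaluated at a. -/
theorem continuous_conj_sigmaWeak (A : H →L[ℂ] H) :
    @Continuous _ _ (sigmaWeak H) (sigmaWeak H) fun a => A * a * star A := by
  let := sigmaWeak H
  have h0 : Continuous fun (a : H →L[ℂ] H) (p : lp (fun _ : ℕ => H) 2 × lp (fun _ : ℕ => H) 2) =>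
      ∑' n, ⟪p.2 n, a (p.1 n)⟫_ℂ := continuous_induced_dom
  refine continuous_induced_rng.2 (continuous_pi fun p => ?_)
  have h : Continuous fun a : H →L[ℂ] H =>
      ∑' n, ⟪lpMap (star A) p.2 n, a (lpMap (star A) p.1 n)⟫_ℂ :=
    continuous_pi_iff.1 h0 (lpMap (star A) p.1, lpMap (star A) p.2)
  refine h.congr fun a => tsum_congr fun n => ?_
  exact ContinuousLinearMap.adjoint_inner_left A _ _

/-- The CP map `a ↦ A a A*` of a contraction `A`. -/
def conjCP (A : H →L[ℂ] H) (hA : ‖A‖ ≤ 1) : CPMap H where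
  toLinearMap := LinearMap.mulRight ℂ (star A) ∘ₗ LinearMap.mulLeft ℂ A
  map_cstarMatrix_nonneg' k M hM := by
    -- The amplification to k × k matrices is conjugation by the diagonal matrix with entries `A`.
    set D : CStarMatrix (Fin k) (Fin k) (H →L[ℂ] H) :=
      CStarMatrix.ofMatrix (Matrix.diagonal fun _ => A)
    have h : M.map (LinearMap.mulRight ℂ (star A) ∘ₗ LinearMap.mulLeft ℂ A) = D * M * star D := by
      ext1 i j
      simp [D, CStarMatrix.mul_apply, CStarMatrix.star_apply, Matrix.diagonal_apply, mul_assoc,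
        apply_ite star]
    exact h ▸ star_right_conjugate_nonneg hM D
  contractive a := by
    change ‖A * a * star A‖ ≤ ‖a‖
    calc ‖A * a * star A‖ ≤ ‖A‖ * ‖a‖ * ‖star A‖ := norm_mul₃_le
      _ ≤ 1 * ‖a‖ * 1 := by
        gcongr
        rwa [norm_star]
      _ = ‖a‖ := by ring
  normal := continuous_conj_sigmaWeak A

theorem conjCP_apply (A : H →L[ℂ] H) (hA : ‖A‖ ≤ 1) (a : H →L[ℂ] H) :
    conjCP A hA a = A * a * star A := rfl

namespace ContractionSemigroup

theorem map_comm (T : ContractionSemigroup H) (s t : ℝ≥0) : T s * T t = T t * T s := by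
  rw [← T.map_add, add_comm, T.map_add]

/-- Expand the square and use ‖T_t* h‖ ≤ ‖h‖. The bound involves only T_t, so strong continuity of T
at 0 passes to the adjoints, although taking adjoints is not strongly continuous in general. -/
theorem norm_star_sub_sq_le (T : ContractionSemigroup H) (t : ℝ≥0) (h : H) :
    ‖star (T t) h - h‖ ^ 2 ≤ 2 * (‖h‖ ^ 2 - (⟪h, T t h⟫_ℂ).re) := by
  have h1 : ‖star (T t) h‖ ≤ ‖h‖ := by
    refine ((star (T t)).le_of_opNorm_le ?_ h).trans_eq (one_mul _)
    rw [norm_star]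
    exact T.contractive t
  have h2 : ⟪star (T t) h, h⟫_ℂ = ⟪h, T t h⟫_ℂ := ContinuousLinearMap.adjoint_inner_left _ _ _
  have h3 := norm_sub_sq (𝕜 := ℂ) (star (T t) h) h
  rw [h2, RCLike.re_eq_complex_re] at h3
  nlinarith [norm_nonneg (star (T t) h)]

theorem norm_star_add_sub_le (T : ContractionSemigroup H) (s t : ℝ≥0) (h : H) :
    ‖star (T (s + t)) h - star (T s) h‖ ≤ ‖star (T t) h - h‖ := by
  have h1 : star (T (s + t)) h - star (T s) h = star (T s) (star (T t) h - h) := by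
    rw [T.map_add, T.map_comm, star_mul, map_sub]
    rfl
  rw [h1]
  refine ((star (T s)).le_of_opNorm_le ?_ _).trans_eq (one_mul _)
  rw [norm_star]
  exact T.contractive s

/-- The contraction T_{min(s,t)}* factors out of the difference, which reduces continuity at every
point to continuity at 0. -/
theorem dist_star_le (T : ContractionSemigroup H) (s t : ℝ≥0) (h : H) :
    dist (star (T s) h) (star (T t) h) ≤ ‖star (T (nndist s t)) h - h‖ := by
  wlog hst : t ≤ s generalizing s t
  · rw [dist_comm, nndist_comm]
    exact this t s (le_of_not_ge hst)
  obtain ⟨r, rfl⟩ := exists_add_of_le hst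
  have h1 : nndist (t + r) t = r := by
    rw [NNReal.nndist_eq, add_tsub_cancel_left, tsub_eq_zero_of_le hst, max_eq_left zero_le]
  rw [h1, dist_eq_norm]
  exact T.norm_star_add_sub_le t r h

/-- The adjoint semigroup is strongly continuous. -/
theorem continuous_star (T : ContractionSemigroup H) (h : H) :
    Continuous fun t => star (T t) h := by
  have h1 : Filter.Tendsto (fun t => ‖star (T t) h - h‖) (nhds 0) (nhds 0) := by
    -- This bound is continuous in t and vanishes at t = 0, where T_0 = I.
    have h2 : Continuous fun t => √(2 * (‖h‖ ^ 2 - (⟪h, T t h⟫_ℂ).re)) := by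
      have := T.continuous h
      fun_prop
    have h3 := h2.tendsto 0
    have h4 : (⟪h, h⟫_ℂ).re = ‖h‖ ^ 2 := (norm_sq_eq_re_inner (𝕜 := ℂ) h).symm
    rw [T.map_zero, one_apply_eq_self, h4, sub_self, mul_zero, Real.sqrt_zero] at h3
    exact squeeze_zero (fun _ => norm_nonneg _)
      (fun t => Real.le_sqrt_of_sq_le (T.norm_star_sub_sq_le t h)) h3
  refine continuous_iff_continuousAt.2 fun t => tendsto_iff_dist_tendsto_zero.2 ?_
  refine squeeze_zero (fun _ => dist_nonneg) (fun s => T.dist_star_le s t h) ?_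
  refine h1.comp ?_
  have h5 : Continuous fun s => nndist s t := by fun_prop
  simpa using h5.tendsto t

/-- The CP-semigroup `a ↦ T_t a T_t*`. -/
def conjSemigroup (T : ContractionSemigroup H) : CPSemigroup H where
  toMap t := conjCP (T t) (T.contractive t)
  map_zero a := by simp [conjCP_apply, T.map_zero]
  map_add s t a := by simp only [conjCP_apply, T.map_add, star_mul, mul_assoc]
  continuous a h g := by
    -- In this form only orbits of the adjoint semigroup depend on t.
    have h1 : ∀ t, ⟪conjCP (T t) (T.contractive t) a h, g⟫_ℂ =
        ⟪a (star (T t) h), star (T t) g⟫_ℂ := fun t =>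
      (ContinuousLinearMap.adjoint_inner_right (T t) _ _).symm
    simp only [h1]
    have h2 := T.continuous_star h
    have h3 := T.continuous_star g
    fun_prop

theorem conjSemigroup_apply (T : ContractionSemigroup H) (t : ℝ≥0) (a : H →L[ℂ] H) :
    T.conjSemigroup t a = T t * a * star (T t) := rfl

end ContractionSemigroup

/-! ### Form-preserving maps and their completions -/

namespace PreRep

variable {V W X : PreRep H}

theorem left_coe (a : H →L[ℂ] H) (x : V.carrier) : V.left a (x : V.Hilb) = (V.act a x : V.Hilb) :=
  ContinuousLinearMap.completion_apply_coe _ _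

theorem left_base_baseIn (a : H →L[ℂ] H) (h : H) :
    (base H).left a (baseIn H h) = baseIn H (a h) :=
  left_coe (V := base H) a h

theorem inner_baseIn (h k : H) : ⟪baseIn H h, baseIn H k⟫_ℂ = ⟪h, k⟫_ℂ :=
  UniformSpace.Completion.inner_coe (E := (base H).carrier) h k

theorem ket_coe (Φ : CPMap H) (a : H →L[ℂ] H) (x : V.carrier) :
    ket Φ V a (x : V.Hilb) = (tmul Φ V a x : (tens Φ V).Hilb) :=
  ContinuousLinearMap.completion_apply_coe _ _

theorem vec_mul (Φ Θ : CPMap H) (a b c : H →L[ℂ] H) (h : H) :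
    vec Φ Θ (c * a) b h = (tens Φ (tens Θ (base H))).left c (vec Φ Θ a b h) := by
  unfold vec
  induction ket Θ (base H) b (baseIn H h) using UniformSpace.Completion.induction_on with
  | hp => exact isClosed_eq (by fun_prop) (by fun_prop)
  | ih x => rw [ket_coe, ket_coe, left_coe, act_tmul]

namespace Hom

theorem hilb_coe (f : Hom V W) (x : V.carrier) : f.hilb (x : V.Hilb) = (f.toLin x : W.Hilb) :=
  ContinuousLinearMap.completion_apply_coe _ _

theorem norm_hilb (f : Hom V W) (k : V.Hilb) : ‖f.hilb k‖ = ‖k‖ := by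
  induction k using UniformSpace.Completion.induction_on with
  | hp => exact isClosed_eq (by fun_prop) (by fun_prop)
  | ih x => rw [hilb_coe, UniformSpace.Completion.norm_coe, UniformSpace.Completion.norm_coe,
      f.norm_map]

/-- The map of the completions as a linear isometry. -/
def isometry (f : Hom V W) : V.Hilb →ₗᵢ[ℂ] W.Hilb := ⟨f.hilb.toLinearMap, f.norm_hilb⟩

theorem hilb_injective (f : Hom V W) : Function.Injective f.hilb := f.isometry.injective

theorem inner_hilb (f : Hom V W) (k l : V.Hilb) : ⟪f.hilb k, f.hilb l⟫_ℂ = ⟪k, l⟫_ℂ :=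
  f.isometry.inner_map_map k l

theorem hilb_left (f : Hom V W) (a : H →L[ℂ] H) (k : V.Hilb) :
    f.hilb (V.left a k) = W.left a (f.hilb k) := by
  induction k using UniformSpace.Completion.induction_on with
  | hp => exact isClosed_eq (by fun_prop) (by fun_prop)
  | ih x => rw [left_coe, hilb_coe, hilb_coe, left_coe, f.map_act]

theorem hilb_hilb {f : Hom V W} {g : Hom W X} {e : Hom V X}
    (h : ∀ x, g.toLin (f.toLin x) = e.toLin x) (k : V.Hilb) : g.hilb (f.hilb k) = e.hilb k := by
  induction k using UniformSpace.Completion.induction_on with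
  | hp => exact isClosed_eq (by fun_prop) (by fun_prop)
  | ih x => rw [hilb_coe, hilb_coe, hilb_coe, h]

/-- The range of an isometry on a complete space is closed, so it suffices to check the inclusion on
the dense algebraic part. -/
theorem range_isometry_le {f : Hom V X} {g : Hom W X}
    (h : LinearMap.range f.toLin ≤ LinearMap.range g.toLin) :
    LinearMap.range f.isometry.toLinearMap ≤ LinearMap.range g.isometry.toLinearMap := by
  rintro _ ⟨k, rfl⟩
  induction k using UniformSpace.Completion.induction_on with
  | hp =>
    have hc : IsClosed (Set.range g.isometry) :=
      g.isometry.isometry.isClosedEmbedding.isClosed_range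
    exact hc.preimage f.isometry.continuous
  | ih x =>
    obtain ⟨y, hy⟩ := h ⟨x, rfl⟩
    refine ⟨(y : W.Hilb), ?_⟩
    change g.hilb y = f.hilb x
    rw [hilb_coe, hilb_coe, hy]

/-- The unitary `U` with `g ∘ U = f`, for form-preserving maps `f` and `g` of equal range. -/
def hilbEquiv (f : Hom V X) (g : Hom W X)
    (h : LinearMap.range f.toLin = LinearMap.range g.toLin) : V.Hilb ≃ₗᵢ[ℂ] W.Hilb :=
  f.isometry.equivRange.trans <|
    (LinearIsometryEquiv.ofEq _ _
      (le_antisymm (range_isometry_le h.le) (range_isometry_le h.ge))).trans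
    g.isometry.equivRange.symm

theorem hilb_hilbEquiv (f : Hom V X) (g : Hom W X)
    (h : LinearMap.range f.toLin = LinearMap.range g.toLin) (k : V.Hilb) :
    g.hilb (hilbEquiv f g h k) = f.hilb k := by
  have h1 := g.isometry.equivRange.apply_symm_apply
    (LinearIsometryEquiv.ofEq _ _
      (le_antisymm (range_isometry_le h.le) (range_isometry_le h.ge)) (f.isometry.equivRange k))
  exact congrArg Subtype.val h1

theorem hilbEquiv_left (f : Hom V X) (g : Hom W X)
    (h : LinearMap.range f.toLin = LinearMap.range g.toLin) (a : H →L[ℂ] H) (k : V.Hilb) :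
    hilbEquiv f g h (V.left a k) = W.left a (hilbEquiv f g h k) :=
  g.hilb_injective <| by simp only [hilb_hilbEquiv, hilb_left]

end Hom

end PreRep

/-! ### Isometries acting on correspondences by composition -/

theorem Corr.inner_hilb {V W : PreRep H} (f : Hom V W) (x y : Corr V) :
    Corr.inner (V := W) (f.hilb ∘L x) (f.hilb ∘L y) = x.inner y := by
  ext k
  refine ext_inner_left ℂ fun h => ?_
  simp only [Corr.inner, ContinuousLinearMap.comp_apply, ContinuousLinearMap.adjoint_inner_right,
    f.inner_hilb]

/-- This is how identities between correspondence elements are tested: after embedding into `H`. -/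
theorem Corr.hilb_injective {V W : PreRep H} (f : Hom V W) {x y : Corr V}
    (h : f.hilb ∘L x = f.hilb ∘L y) : x = y :=
  ContinuousLinearMap.ext fun k => f.hilb_injective (congrArg (fun z => z k) h)

theorem Corr.inner_baseIn (a b : H →L[ℂ] H) :
    Corr.inner (V := base H) (baseIn H ∘L a) (baseIn H ∘L b) = star a * b := by
  ext k
  refine ext_inner_left ℂ fun h => ?_
  rw [Corr.inner, ContinuousLinearMap.comp_apply, ContinuousLinearMap.adjoint_inner_right]
  exact (PreRep.inner_baseIn _ _).trans (ContinuousLinearMap.adjoint_inner_right a _ _).symm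

/-- The isomorphism `x ↦ U ∘ x` of correspondences, where `U` is the unitary with `g ∘ U = f`. -/
def CorrIso.ofRange {V W X : PreRep H} (f : Hom V X) (g : Hom W X)
    (h : LinearMap.range f.toLin = LinearMap.range g.toLin) : CorrIso V W where
  toFun x := (Hom.hilbEquiv f g h : V.Hilb →L[ℂ] W.Hilb) ∘L x
  invFun y := ((Hom.hilbEquiv f g h).symm : W.Hilb →L[ℂ] V.Hilb) ∘L y
  left_inv x := by ext; simp
  right_inv y := by ext; simp
  map_add' x y := by ext; simp
  map_smul' r x := by ext; simp
  map_inner x y := by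
    ext k
    refine ext_inner_left ℂ fun h => ?_
    simp [Corr.inner, ContinuousLinearMap.adjoint_inner_right]
  map_right x a := rfl
  map_left c x := by
    ext k
    exact Hom.hilbEquiv_left f g h c (x k)

theorem CorrIso.hilb_ofRange {V W X : PreRep H} (f : Hom V X) (g : Hom W X)
    (h : LinearMap.range f.toLin = LinearMap.range g.toLin) (x : Corr V) :
    g.hilb ∘L CorrIso.ofRange f g h x = f.hilb ∘L x :=
  ContinuousLinearMap.ext fun k => Hom.hilb_hilbEquiv f g h (x k)

/-! ### Tensor products with `a ↦ T a T*` -/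

namespace PreRep

variable {V W X : PreRep H} {Φ Ψ Θ : CPMap H} {A B C : H →L[ℂ] H}

/-- The linear map `a ⊗ x ↦ a A* · f x`. -/
def conjTensLin (Φ : CPMap H) (A : H →L[ℂ] H) (f : V.carrier →ₗ[ℂ] X.carrier) :
    (tens Φ V).carrier →ₗ[ℂ] X.carrier :=
  TensorProduct.lift <| LinearMap.mk₂ ℂ (fun a x => X.act (a * star A) (f x))
    (by intros; simp [add_mul]) (by intros; simp) (by intros; simp) (by intros; simp)

theorem conjTensLin_tmul (f : V.carrier →ₗ[ℂ] X.carrier) (a : H →L[ℂ] H) (x : V.carrier) :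
    conjTensLin Φ A f (tmul Φ V a x) = X.act (a * star A) (f x) := rfl

/-- For `Φ a = A a A*`, the form-preserving map `a ⊗ x ↦ a A* · f x`. -/
def Hom.conjTens (hΦ : ∀ a, Φ a = A * a * star A) (f : Hom V X) : Hom (tens Φ V) X where
  toLin := conjTensLin Φ A f.toLin
  map_form x y := by
    induction x using tens_induction with
    | h0 => simp
    | h2 x x' hx hx' => simp only [map_add, LinearMap.add_apply, hx, hx']
    | h1 a x =>
      induction y using tens_induction with
      | h0 => simp
      | h2 y y' hy hy' => simp only [map_add, hy, hy']
      | h1 c y =>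
        -- ⟨f x, A a* c A* f y⟩ = ⟨aA* f x, cA* f y⟩.
        rw [form_tmul, ← f.map_form, f.map_act, hΦ,
          conjTensLin_tmul, conjTensLin_tmul, X.act_adj, ← Module.End.mul_apply, ← map_mul, star_mul, star_star]
        simp only [mul_assoc]
  map_act c x := by
    induction x using tens_induction with
    | h0 => simp
    | h2 x x' hx hx' => simp only [map_add, hx, hx']
    | h1 a x =>
      rw [act_tmul, conjTensLin_tmul, conjTensLin_tmul, mul_assoc, map_mul]
      rfl

theorem Hom.conjTens_tmul (hΦ : ∀ a, Φ a = A * a * star A) (f : Hom V X) (a : H →L[ℂ] H)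
    (x : V.carrier) :
    (f.conjTens hΦ).toLin (tmul Φ V a x) = X.act (a * star A) (f.toLin x) := rfl

theorem Hom.hilb_conjTens_ket (hΦ : ∀ a, Φ a = A * a * star A) (f : Hom V X) (a : H →L[ℂ] H)
    (k : V.Hilb) :
    (f.conjTens hΦ).hilb (ket Φ V a k) = X.left (a * star A) (f.hilb k) := by
  induction k using UniformSpace.Completion.induction_on with
  | hp => exact isClosed_eq (by fun_prop) (by fun_prop)
  | ih x => rw [ket_coe, hilb_coe, hilb_coe, left_coe, conjTens_tmul]

/-- The image of a ⊗ I ⊗ x is aA*B* f x = a(BA)* f x. -/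
theorem Hom.conjTens_split (h : ∀ a, Θ a = Ψ (Φ a)) (hC : C = B * A) (hΘ : ∀ a, Θ a = C * a * star C)
    (hΦ : ∀ a, Φ a = A * a * star A) (hΨ : ∀ a, Ψ a = B * a * star B) (f : Hom V X)
    (x : (tens Θ V).carrier) :
    ((f.conjTens hΨ).conjTens hΦ).toLin ((split h V).toLin x) = (f.conjTens hΘ).toLin x := by
  induction x using tens_induction with
  | h0 => simp
  | h2 x y hx hy => simp only [map_add, hx, hy]
  | h1 a x =>
    change X.act (a * star A) (X.act (1 * star B) (f.toLin x)) = X.act (a * star C) _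
    rw [hC, ← Module.End.mul_apply, ← map_mul, one_mul, star_mul, mul_assoc]

theorem Hom.conjTens_idTens (hΦ : ∀ a, Φ a = A * a * star A) {f : Hom V W} {g : Hom W X}
    {e : Hom V X} (h : ∀ x, g.toLin (f.toLin x) = e.toLin x) (x : (tens Φ V).carrier) :
    (g.conjTens hΦ).toLin ((f.idTens Φ).toLin x) = (e.conjTens hΦ).toLin x := by
  induction x using tens_induction with
  | h0 => simp
  | h2 x y hx hy => simp only [map_add, hx, hy]
  | h1 a x => exact congrArg (X.act (a * star A)) (h x)

/-! ### Ranges of the embeddings -/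

theorem exists_apply_eq {x : H} (hx : x ≠ 0) (y : H) : ∃ a : H →L[ℂ] H, a x = y :=
  ⟨(⟪x, x⟫_ℂ)⁻¹ • (innerSL ℂ x).smulRight y, by
    rw [smul_apply, ContinuousLinearMap.smulRight_apply, smul_smul,
      innerSL_apply_apply, inv_mul_cancel₀ (inner_self_ne_zero.2 hx), one_smul]⟩

/-- The range of `f` is invariant under `B(H)`: aA* · f x = f(aA* · x). -/
theorem Hom.range_conjTens_le (hΦ : ∀ a, Φ a = A * a * star A) (f : Hom V X) :
    LinearMap.range (f.conjTens hΦ).toLin ≤ LinearMap.range f.toLin := by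
  rintro _ ⟨z, rfl⟩
  induction z using tens_induction with
  | h0 => simp
  | h2 x y hx hy => rw [map_add]; exact add_mem hx hy
  | h1 a x => exact ⟨V.act (a * star A) x, f.map_act _ _⟩

theorem Hom.range_conjTens (hΦ : ∀ a, Φ a = A * a * star A) (hA : A ≠ 0) (f : Hom V (base H)) :
    LinearMap.range (f.conjTens hΦ).toLin = LinearMap.range f.toLin := by
  refine le_antisymm (f.range_conjTens_le hΦ) ?_
  rintro _ ⟨x, rfl⟩
  by_cases hx : f.toLin x = 0
  · rw [hx]
    exact zero_mem _
  obtain ⟨w, hw⟩ : ∃ w : H, star A w ≠ 0 := by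
    by_contra! h
    exact hA (star_eq_zero.1 (ContinuousLinearMap.ext h))
  obtain ⟨b, hb⟩ := exists_apply_eq (H := H) hx w
  obtain ⟨a, ha⟩ := exists_apply_eq (H := H) hw (f.toLin x)
  -- Transitivity gives the chain f x ↦ w ↦ A* w ↦ f x under b, A* and a.
  refine ⟨tmul Φ V a (V.act b x), ?_⟩
  rw [conjTens_tmul, f.map_act]
  change a (star A (b (f.toLin x))) = f.toLin x
  rw [hb, ha]

theorem Hom.range_conjTens_zero (hΦ : ∀ a, Φ a = A * a * star A) (hA : A = 0) (f : Hom V X) :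
    LinearMap.range (f.conjTens hΦ).toLin = ⊥ := by
  refine LinearMap.range_eq_bot.2 (LinearMap.ext fun z => ?_)
  induction z using tens_induction with
  | h0 => simp
  | h2 x y hx hy => rw [map_add, hx, hy]; simp
  | h1 a x => simp [conjTens_tmul, hA]

theorem Hom.range_conjTens_congr (hΦ : ∀ a, Φ a = A * a * star A) {f : Hom V (base H)}
    {g : Hom W (base H)} (h : LinearMap.range f.toLin = LinearMap.range g.toLin) :
    LinearMap.range (f.conjTens hΦ).toLin = LinearMap.range (g.conjTens hΦ).toLin := by
  by_cases hA : A = 0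
  · rw [range_conjTens_zero hΦ hA, range_conjTens_zero hΦ hA]
  · rw [range_conjTens hΦ hA, range_conjTens hΦ hA, h]

/-- If A = 0 both sides vanish; otherwise the factor Φ can be dropped in either position.
Commutation of `A` and `B` plays no role here. -/
theorem Hom.range_conjTens_comm (hΦ : ∀ a, Φ a = A * a * star A)
    (hΨ : ∀ a, Ψ a = B * a * star B) (f : Hom V (base H)) :
    LinearMap.range ((f.conjTens hΨ).conjTens hΦ).toLin =
      LinearMap.range ((f.conjTens hΦ).conjTens hΨ).toLin := by
  by_cases hA : A = 0
  · rw [range_conjTens_zero hΦ hA]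
    refine (le_bot_iff.1 ?_).symm
    exact (range_conjTens_le hΨ _).trans (range_conjTens_zero hΦ hA f).le
  · rw [range_conjTens hΦ hA, range_conjTens_congr hΨ (range_conjTens hΦ hA f)]

/-- The identity map. -/
def Hom.id (V : PreRep H) : Hom V V := ⟨LinearMap.id, fun _ _ => rfl, fun _ _ => rfl⟩

theorem Hom.hilb_id (k : V.Hilb) : (Hom.id V).hilb k = k := by
  induction k using UniformSpace.Completion.induction_on with
  | hp => exact isClosed_eq (by fun_prop) (by fun_prop)
  | ih x => rw [hilb_coe]; rfl

/-! ### Elementary tensors as operator words on `H` -/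

theorem Hom.base_conjTens_ket (hΦ : ∀ a, Φ a = A * a * star A) (f : Hom V (base H))
    (a : H →L[ℂ] H) (x : Corr V) {b : H →L[ℂ] H} (h : f.hilb ∘L x = baseIn H ∘L b) :
    (f.conjTens hΦ).hilb ∘L (ket Φ V a ∘L x) = baseIn H ∘L (a * star A * b) := by
  ext k
  have h1 : f.hilb (x k) = baseIn H (b k) := congrArg (fun z => z k) h
  exact (hilb_conjTens_ket hΦ f a (x k)).trans
    ((congrArg _ h1).trans (left_base_baseIn (a * star A) (b k)))

/-- The identity of `H`, seen as a map of pre-Hilbert spaces. -/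
abbrev idBase (H : Type u) [NormedAddCommGroup H] [InnerProductSpace ℂ H] [CompleteSpace H] :
    Hom (base H) (base H) := Hom.id (base H)

theorem idBase_baseIn (c : H →L[ℂ] H) :
    (idBase H).hilb ∘L (baseIn H ∘L c) = baseIn H ∘L c :=
  ContinuousLinearMap.ext fun _ => Hom.hilb_id _

theorem hilb_elem₃ (hΦ : ∀ a, Φ a = A * a * star A) (hΨ : ∀ a, Ψ a = B * a * star B)
    (a b c : H →L[ℂ] H) :
    (((idBase H).conjTens hΨ).conjTens hΦ).hilb ∘L elem₃ Φ Ψ a b c =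
      baseIn H ∘L (a * star A * (b * star B * c)) :=
  Hom.base_conjTens_ket hΦ _ a _ (Hom.base_conjTens_ket hΨ _ b _ (idBase_baseIn c))

theorem hilb_elem₄ (hΦ : ∀ a, Φ a = A * a * star A) (hΨ : ∀ a, Ψ a = B * a * star B)
    (hΘ : ∀ a, Θ a = C * a * star C) (a b c d : H →L[ℂ] H) :
    ((((idBase H).conjTens hΘ).conjTens hΨ).conjTens hΦ).hilb ∘L elem₄ Φ Ψ Θ a b c d =
      baseIn H ∘L (a * star A * (b * star B * (c * star C * d))) :=
  Hom.base_conjTens_ket hΦ _ a _ (Hom.base_conjTens_ket hΨ _ b _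
    (Hom.base_conjTens_ket hΘ _ c _ (idBase_baseIn d)))

theorem hilb_vec (hΦ : ∀ a, Φ a = A * a * star A) (hΨ : ∀ a, Ψ a = B * a * star B)
    (a b : H →L[ℂ] H) (h : H) :
    (((idBase H).conjTens hΨ).conjTens hΦ).hilb (vec Φ Ψ a b h) =
      baseIn H ((a * star A * (b * star B)) h) := by
  have h1 := congrArg (fun z => z h) (hilb_elem₃ hΦ hΨ a b 1)
  rw [mul_one] at h1
  exact h1

end PreRep

/-! ### The flip and its tensor products with the identity -/

variable {V W : PreRep H} {Φ Ψ Θ : CPMap H} {A B C : H →L[ℂ] H}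

/-- The flip `B(H) ⊗_Φ B(H) ⊗_Ψ V → B(H) ⊗_Ψ B(H) ⊗_Φ V` for `Φ a = A a A*` and `Ψ a = B a B*`,
over a form-preserving map `f : V → H`. -/
def CorrIso.flip (hΦ : ∀ a, Φ a = A * a * star A) (hΨ : ∀ a, Ψ a = B * a * star B)
    (f : Hom V (base H)) : CorrIso (tens Φ (tens Ψ V)) (tens Ψ (tens Φ V)) :=
  CorrIso.ofRange ((f.conjTens hΨ).conjTens hΦ) ((f.conjTens hΦ).conjTens hΨ)
    (f.range_conjTens_comm hΦ hΨ)

theorem CorrIso.hilb_flip (hΦ : ∀ a, Φ a = A * a * star A) (hΨ : ∀ a, Ψ a = B * a * star B)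
    (f : Hom V (base H)) (x : Corr (tens Φ (tens Ψ V))) :
    ((f.conjTens hΦ).conjTens hΨ).hilb ∘L CorrIso.flip hΦ hΨ f x =
      ((f.conjTens hΨ).conjTens hΦ).hilb ∘L x :=
  CorrIso.hilb_ofRange _ _ _ x

/-- The isomorphism `I ⊗ v`, for the isomorphism `v` given by maps `f` and `g` of equal range. -/
def CorrIso.idTens (hΦ : ∀ a, Φ a = A * a * star A) (f : Hom V (base H)) (g : Hom W (base H))
    (h : LinearMap.range f.toLin = LinearMap.range g.toLin) : CorrIso (tens Φ V) (tens Φ W) :=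
  CorrIso.ofRange (f.conjTens hΦ) (g.conjTens hΦ) (Hom.range_conjTens_congr hΦ h)

theorem CorrIso.hilb_idTens (hΦ : ∀ a, Φ a = A * a * star A) (f : Hom V (base H))
    (g : Hom W (base H)) (h : LinearMap.range f.toLin = LinearMap.range g.toLin)
    (x : Corr (tens Φ V)) :
    (g.conjTens hΦ).hilb ∘L CorrIso.idTens hΦ f g h x = (f.conjTens hΦ).hilb ∘L x :=
  CorrIso.hilb_ofRange _ _ _ x

theorem isIdTensor_idTens (hΦ : ∀ a, Φ a = A * a * star A) (f : Hom V (base H))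
    (g : Hom W (base H)) (h : LinearMap.range f.toLin = LinearMap.range g.toLin) :
    IsIdTensor Φ (CorrIso.ofRange f g h) (CorrIso.idTens hΦ f g h) := by
  intro a x
  refine Corr.hilb_injective (g.conjTens hΦ) ((CorrIso.hilb_idTens hΦ f g h _).trans ?_)
  ext k
  refine (Hom.hilb_conjTens_ket hΦ f a (x k)).trans ?_
  refine Eq.trans ?_ (Hom.hilb_conjTens_ket hΦ g a (CorrIso.ofRange f g h x k)).symm
  exact congrArg _ (Hom.hilb_hilbEquiv f g h (x k)).symm

/-- Embedded in `H`, the flip leaves the word aA*bB*cC*d unchanged. Both inner products are then the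
same word, the outer C and C* coming from Θ on the right-hand side. -/
theorem isTensorId_flip (hΦ : ∀ a, Φ a = A * a * star A) (hΨ : ∀ a, Ψ a = B * a * star B)
    (hΘ : ∀ a, Θ a = C * a * star C) :
    IsTensorId (CorrIso.flip hΦ hΨ (idBase H)) Θ
      (CorrIso.flip hΦ hΨ ((idBase H).conjTens hΘ)) := by
  intro a b c d a' b' c' d'
  rw [← Corr.inner_hilb ((((idBase H).conjTens hΘ).conjTens hΦ).conjTens hΨ),
    CorrIso.hilb_flip, hilb_elem₄, hilb_elem₄, Corr.inner_baseIn,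
    ← Corr.inner_hilb (((idBase H).conjTens hΦ).conjTens hΨ),
    CorrIso.hilb_flip, hilb_elem₃, hilb_elem₃, Corr.inner_baseIn, hΘ]
  simp only [star_mul, star_star, mul_assoc]

/-- The two unit tensors embed as A*B* and B*A*, so commutation is exactly what is needed. -/
theorem CorrIso.flip_one (hΦ : ∀ a, Φ a = A * a * star A) (hΨ : ∀ a, Ψ a = B * a * star B)
    (hAB : A * B = B * A) :
    CorrIso.flip hΦ hΨ (idBase H) (elem₃ Φ Ψ 1 1 1) = elem₃ Ψ Φ 1 1 1 := by
  refine Corr.hilb_injective (((idBase H).conjTens hΦ).conjTens hΨ) ?_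
  rw [CorrIso.hilb_flip, hilb_elem₃, hilb_elem₃]
  simp only [one_mul, mul_one, ← star_mul, hAB]

theorem commuteStrongly_of_conj (hΦ : ∀ a, Φ a = A * a * star A)
    (hΨ : ∀ a, Ψ a = B * a * star B) (hAB : A * B = B * A) : CommuteStrongly Ψ Φ := by
  refine ⟨Hom.hilbEquiv _ _ ((idBase H).range_conjTens_comm hΦ hΨ), fun a h => ?_,
    fun a b c h => ?_, fun a b z h => ?_⟩
  · refine (((idBase H).conjTens hΦ).conjTens hΨ).hilb_injective ?_
    rw [Hom.hilb_hilbEquiv, hilb_vec, hilb_vec]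
    simp only [one_mul, mul_assoc, ← star_mul, hAB]
  · rw [vec_mul, Hom.hilbEquiv_left]
  · simp only [vec, map_smul]

/-! ### Compatibility with the semigroup laws -/

theorem hilb_splitFirst {P : CPSemigroup H} {T : ContractionSemigroup H}
    (hP : ∀ t a, P t a = T t * a * star (T t)) (s s' : ℝ≥0) (f : Hom V (base H))
    (x : Corr (tens (P (s + s')) V)) :
    ((f.conjTens (hP s')).conjTens (hP s)).hilb ∘L splitFirst P s s' V x =
      (f.conjTens (hP (s + s'))).hilb ∘L x :=
  ContinuousLinearMap.ext fun k => Hom.hilb_hilb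
    (Hom.conjTens_split (P.map_add' s s') (by rw [T.map_add, T.map_comm])
      (hP (s + s')) (hP s) (hP s') f) (x k)

theorem hilb_splitSecond (hΦ : ∀ a, Φ a = A * a * star A) {P : CPSemigroup H}
    {T : ContractionSemigroup H} (hP : ∀ t a, P t a = T t * a * star (T t)) (s s' : ℝ≥0)
    (x : Corr (tens Φ (tens (P (s + s')) (base H)))) :
    ((((idBase H).conjTens (hP s')).conjTens (hP s)).conjTens hΦ).hilb ∘L
        splitSecond Φ P s s' x =
      (((idBase H).conjTens (hP (s + s'))).conjTens hΦ).hilb ∘L x :=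
  ContinuousLinearMap.ext fun k => Hom.hilb_hilb
    (Hom.conjTens_idTens hΦ (Hom.conjTens_split (P.map_add' s s')
      (by rw [T.map_add, T.map_comm]) (hP (s + s')) (hP s) (hP s') (idBase H))) (x k)

/-- Semigroups `a ↦ T_t a T_t*` of commuting contraction semigroups commute strongly. -/
theorem stronglyCommute_of_conj {R S : CPSemigroup H} {T₁ T₂ : ContractionSemigroup H}
    (hR : ∀ t a, R t a = T₁ t * a * star (T₁ t)) (hS : ∀ t a, S t a = T₂ t * a * star (T₂ t))
    (hcomm : ∀ s t, T₁ s * T₂ t = T₂ t * T₁ s) : StronglyCommute R S := by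
  -- The unitary u for (R_s, S_t) starts from the product over S_t, then R_s, opposite to v_{s,t};
  -- hence the swapped arguments and the `.symm`.
  refine ⟨fun s t => commuteStrongly_of_conj (hS t) (hR s) (hcomm s t).symm,
    fun s t => CorrIso.flip (hR s) (hS t) (idBase H),
    fun s t => CorrIso.flip_one (hR s) (hS t) (hcomm s t), fun s s' t => ?_, fun s t t' => ?_⟩
  · refine ⟨_, _, isIdTensor_idTens (hR s) _ _ ((idBase H).range_conjTens_comm (hR s') (hS t)),
      isTensorId_flip (hR s) (hS t) (hR s'), fun x => ?_⟩
    refine Corr.hilb_injective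
      ((((idBase H).conjTens (hR s')).conjTens (hR s)).conjTens (hS t)) ?_
    -- Each of the maps is absorbed by the embeddings, and both sides become the embedding of x.
    rw [hilb_splitSecond (hS t) hR, CorrIso.hilb_flip, CorrIso.hilb_flip, CorrIso.hilb_idTens,
      hilb_splitFirst hR]
  · refine ⟨_, _, isTensorId_flip (hR s) (hS t) (hS t'),
      isIdTensor_idTens (hS t) _ _ ((idBase H).range_conjTens_comm (hR s) (hS t')),
      fun x => ?_⟩
    refine Corr.hilb_injective
      ((((idBase H).conjTens (hR s)).conjTens (hS t')).conjTens (hS t)) ?_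
    rw [hilb_splitFirst hS, CorrIso.hilb_flip, CorrIso.hilb_idTens, CorrIso.hilb_flip,
      hilb_splitSecond (hR s) hS]

end CPDil

end
theorem proposition2p18 {H : Type*} [NormedAddCommGroup H] [InnerProductSpace ℂ H]
    [CompleteSpace H] (T₁ T₂ : CPDil.ContractionSemigroup H)
    (hcomm : ∀ s t : ℝ≥0, T₁ s * T₂ t = T₂ t * T₁ s) :
    ∃ φ₁ φ₂ : CPDil.CPSemigroup H,
      (∀ (t : ℝ≥0) (a : H →L[ℂ] H), φ₁ t a = T₁ t * a * star (T₁ t)) ∧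
      (∀ (t : ℝ≥0) (a : H →L[ℂ] H), φ₂ t a = T₂ t * a * star (T₂ t)) ∧
      CPDil.StronglyCommute φ₁ φ₂ := by
  exact ⟨T₁.conjSemigroup, T₂.conjSemigroup, T₁.conjSemigroup_apply, T₂.conjSemigroup_apply,
    CPDil.stronglyCommute_of_conj T₁.conjSemigroup_apply T₂.conjSemigroup_apply hcomm⟩
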